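/- Graphs are finite, undirected, without loops or multiple edges. The tensor product of a nonempty family of graphs $(G_i)_{i\in I}$ is the graph on $\prod_{i\in I}V(G_i)$ in which $x$ and $y$ are adjacent if and only if $x_iy_i$ is an edge of $G_i$ for every $i\in I$. Two graphs are homomorphically equivalent if each admits a homomorphism to the other, and a core of a graph $G$ is a graph with the smallest number of vertices among all graphs that are homomorphically equivalent to $G$. For every integer $k\ge 0$ with $k\ne 1$ there is a family of $\binom{2k}{k}$ pairwise non-isomorphic graphs, each of which has at least $16k^2+80k+12$ and at most $48k^2+48k+12$ vertices, such that the core of the tensor product of the family has more than $$4\,(16k^2+80k+2)^{\binom{2k}{k}}$$ vertices. -/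

import Mathlib

/-- The tensor (categorical) product of a nonempty family of graphs: its vertices are the choice
functions, and two of them are adjacent when they are adjacent in every coordinate. -/
def tensorProduct {ι : Type*} [Nonempty ι] {V : ι → Type*} (G : ∀ i, SimpleGraph (V i)) :
    SimpleGraph (∀ i, V i) where
  Adj x y := ∀ i, (G i).Adj (x i) (y i)
  symm := ⟨fun _ _ h i => (h i).symm⟩
  loopless := ⟨fun _ h => (G (Classical.arbitrary ι)).irrefl (h (Classical.arbitrary ι))⟩

/-- Two graphs are homomorphically equivalent if each admits a homomorphism to the other. -/
def HomEquivalent {V W : Type*} (G : SimpleGraph V) (H : SimpleGraph W) : Prop :=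
  Nonempty (G →g H) ∧ Nonempty (H →g G)

/-- `C` is a core of `G`: it is homomorphically equivalent to `G`, and no graph that is
homomorphically equivalent to `G` has fewer vertices. -/
def IsCoreOf {n : ℕ} {V : Type*} (C : SimpleGraph (Fin n)) (G : SimpleGraph V) : Prop :=
  HomEquivalent C G ∧
    ∀ (m : ℕ) (H : SimpleGraph (Fin m)), HomEquivalent H G → n ≤ m

instance choose_two_mul_neZero (k : ℕ) : NeZero ((2 * k).choose k) :=
  ⟨(Nat.choose_pos (by omega)).ne'⟩

/-! The factors are graphs on `Fin 3 × Fin M`, indexed by the `k`-subsets `S` of a `2k`-set. Each is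
covered by its only three cliques of order `r = M + 1`, arranged in a ring so that any two share
exactly one vertex.

A product of such cliques, one per factor, is a power of `K_r`. A homomorphism into another such
graph sends it into one `r`-clique (`complete_power_hom_mem_clique`), hence reads a single
coordinate by Greenwell–Lovász (`complete_power_hom`). As cliques of a factor intersect, that
coordinate does not depend on the cliques chosen. So every homomorphism from the product to a factor
is a homomorphism of one factor applied to its coordinate (`cliqueRing_product_hom`).

Homomorphisms between factors are injective, because the cross edges exclude an `r`-colouring
(`cliqueRing_hom_injective`). They therefore do not lower degrees, and the degrees encode `S` so
that a map from the graph of `S` to that of `T` forces `S ⊆ T` (`cliqueRing_subset_of_hom`). The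
`k`-subsets form an antichain, so an endomorphism of the product acts injectively in each coordinate
separately. The product is thus its own core, with `(3M)^N` vertices, `N = (2k).choose k`. -/

/-- A function of finitely many coordinates that is unchanged by every modification of a single
coordinate in `T` depends only on the coordinates outside `T`. -/
theorem eq_of_update_invariant {ι β : Type*} {α : ι → Type*} [DecidableEq ι]
    (F : (∀ i, α i) → β) (T : Finset ι)
    (h : ∀ i ∈ T, ∀ x a, F (Function.update x i a) = F x) (x y : ∀ i, α i)
    (hxy : ∀ i ∉ T, x i = y i) : F x = F y := by
  induction T using Finset.induction_on generalizing x with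
  | empty => exact congrArg F (funext fun i => hxy i (by simp))
  | insert j T hj ih =>
    rw [← h j (Finset.mem_insert_self j T) x (y j)]
    refine ih (fun i hi => h i (Finset.mem_insert_of_mem hi)) _ fun i hi => ?_
    by_cases hij : i = j
    · subst hij; simp
    · rw [Function.update_of_ne hij]
      exact hxy i (by simp [hij, hi])

/-! ### Homomorphisms from powers of complete graphs -/

theorem exists_ne_three {r : ℕ} (hr : 4 ≤ r) (a b c : Fin r) : ∃ d, d ≠ a ∧ d ≠ b ∧ d ≠ c := by
  obtain ⟨d, hd⟩ := Finset.exists_mem_notMem_of_card_lt_card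
    (s := ({a, b, c} : Finset (Fin r))) (t := Finset.univ)
    (lt_of_le_of_lt Finset.card_le_three (by simp; omega))
  exact ⟨d, by simpa using hd.2⟩

/-- Colourings of a power of a complete graph with as many colours as the complete graph has
vertices are projections up to a permutation of the colours (Greenwell and Lovász). -/
theorem complete_power_hom {ι : Type*} [Finite ι] {r : ℕ} (hr : 4 ≤ r) :
    ∀ f : (ι → Fin r) → Fin r, (∀ x y, (∀ i, x i ≠ y i) → f x ≠ f y) →
      ∃ (j : ι) (σ : Fin r → Fin r), Function.Injective σ ∧ ∀ x, f x = σ (x j) := by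
  induction ι using Finite.induction_empty_option with
  | of_equiv e ih =>
    rename_i α β
    intro f hf
    obtain ⟨j, σ, hσ, h⟩ := ih (fun x => f (x ∘ e.symm))
      (fun x y hxy => hf _ _ fun i => hxy _)
    refine ⟨e j, σ, hσ, fun x => ?_⟩
    have := h (x ∘ e)
    simpa [Function.comp_assoc] using this
  | h_empty =>
    intro f hf
    exact absurd rfl (hf PEmpty.elim PEmpty.elim fun i => i.elim)
  | h_option ih =>
    rename_i α _
    intro f hf
    let cons (a : Fin r) (l : α → Fin r) : Option α → Fin r := fun o => o.elim a l
    have hcons : ∀ x : Option α → Fin r, x = cons (x none) (fun i => x (some i)) := fun x => by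
      funext o; cases o <;> rfl
    have key : ∀ a b l l', a ≠ b → (∀ i, l i ≠ l' i) → f (cons a l) ≠ f (cons b l') := by
      intro a b l l' hab hl
      refine hf _ _ fun o => ?_
      cases o with
      | none => exact hab
      | some i => exact hl i
    -- If some fibre over the old coordinates receives all colours, `f` reads the new coordinate;
    -- otherwise every fibre repeats a colour and the new coordinate is irrelevant.
    by_cases h : ∃ l, Function.Injective fun a => f (cons a l)
    · obtain ⟨l, hl⟩ := h
      have step : ∀ l₁ l₂, (∀ i, l₁ i ≠ l₂ i) → (Function.Injective fun a => f (cons a l₁)) →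
          ∀ a, f (cons a l₂) = f (cons a l₁) := by
        intro l₁ l₂ h12 h1 a
        obtain ⟨b, hb⟩ := (Finite.injective_iff_surjective.1 h1) (f (cons a l₂))
        by_cases hab : b = a
        · rw [← hb, hab]
        · exact absurd hb (key b a l₁ l₂ hab h12)
      refine ⟨none, fun a => f (cons a l), hl, fun x => ?_⟩
      choose u hu using fun i => exists_ne_three hr (l i) (x (some i)) (l i)
      have h1 := step l u (fun i => (hu i).1.symm) hl
      have h2 : Function.Injective fun a => f (cons a u) := by
        simpa only [h1] using hl
      conv_lhs => rw [hcons x]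
      rw [step u _ (fun i => (hu i).2.1) h2, h1]
    · have h' : ∀ l, ∃ a b, a ≠ b ∧ f (cons a l) = f (cons b l) := by
        intro l
        by_contra hc
        push Not at hc
        exact h ⟨l, fun a b hab => by_contra fun hne => hc a b hne hab⟩
      choose p q hpq hc using h'
      -- The repeated colour occurs at `p l'` and `q l'`, and `a` differs from at least one of them.
      have avoid : ∀ a l l', (∀ i, l i ≠ l' i) → f (cons a l) ≠ f (cons (p l') l') := by
        intro a l l' hl
        by_cases ha : a = p l'
        · rw [hc l']
          exact key _ _ _ _ (ha ▸ hpq l') hl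
        · exact key _ _ _ _ ha hl
      obtain ⟨j, τ, hτ, hj⟩ := ih (fun l => f (cons (p l) l)) fun l l' hl => avoid _ _ _ hl
      refine ⟨some j, τ, hτ, fun x => ?_⟩
      conv_lhs => rw [hcons x]
      set l : α → Fin r := fun i => x (some i)
      obtain ⟨t, ht⟩ := (Finite.injective_iff_surjective.1 hτ) (f (cons (x none) l))
      by_cases htj : t = l j
      · rw [← ht, htj]
      · exfalso
        classical
        choose u hu using fun i => exists_ne_three hr (l i) (l i) (l i)
        -- This tuple differs from `l` everywhere, yet its repeated colour is `τ t`, the colour of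
        -- `x`.
        refine avoid (x none) l (Function.update u j t) (fun i => ?_) ?_
        · by_cases hi : i = j
          · subst hi; simpa using Ne.symm htj
          · simpa [hi] using (hu i).1.symm
        · rw [← ht]
          have := hj (Function.update u j t)
          simp only [Function.update_self] at this
          exact this.symm

/-- Applied in each coordinate, this extends a triangle in a power of `K_r` to an `r`-clique. -/
theorem exists_injective_extending_triple {r : ℕ} (hr : 3 ≤ r) (a b c : Fin r) (hab : a ≠ b)
    (hac : a ≠ c) (hbc : b ≠ c) :
    ∃ σ : Fin r → Fin r, Function.Injective σ ∧ σ ⟨0, by omega⟩ = a ∧ σ ⟨1, by omega⟩ = b ∧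
      σ ⟨2, by omega⟩ = c := by
  let p : Fin r → Fin r := fun t => if (t : ℕ) = 0 then a else if (t : ℕ) = 1 then b else c
  obtain ⟨g, hg⟩ := Finset.exists_equiv_extend_of_card_eq (α := Fin r) (t := Finset.univ)
    (by simp) (s := {⟨0, by omega⟩, ⟨1, by omega⟩, ⟨2, by omega⟩}) (f := p) (by simp) (by
      intro x hx y hy hxy
      simp only [Finset.coe_insert, Finset.coe_singleton, Set.mem_insert_iff,
        Set.mem_singleton_iff] at hx hy
      rcases hx with rfl | rfl | rfl <;> rcases hy with rfl | rfl | rfl <;>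
        simp_all [p, eq_comm])
  refine ⟨fun t => g t, fun x y hxy => g.injective (Subtype.ext hxy), ?_, ?_, ?_⟩
  · exact (hg _ (by simp)).trans (by simp [p])
  · exact (hg _ (by simp)).trans (by simp [p])
  · exact (hg _ (by simp)).trans (by simp [p])

/-- The image of a power of `K_r` lies in a single `r`-clique if no two `r`-cliques of the target
share an edge. -/
theorem complete_power_hom_mem_clique {ι W C : Type*} {r : ℕ} (hr : 4 ≤ r) (H : SimpleGraph W)
    (κ : C → Fin r → W)
    (hclique : ∀ c : Fin r → W, (∀ a b, a ≠ b → H.Adj (c a) (c b)) →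
      ∃ d, ∀ a, c a ∈ Set.range (κ d))
    (huniq : ∀ d e u v, u ≠ v → u ∈ Set.range (κ d) → v ∈ Set.range (κ d) →
      u ∈ Set.range (κ e) → v ∈ Set.range (κ e) → d = e)
    (f : (ι → Fin r) → W) (hf : ∀ x y, (∀ i, x i ≠ y i) → H.Adj (f x) (f y)) :
    ∃ d, ∀ x, f x ∈ Set.range (κ d) := by
  have triple : ∀ x y u : ι → Fin r, (∀ i, x i ≠ y i) → (∀ i, x i ≠ u i) → (∀ i, y i ≠ u i) →
      ∃ d, f x ∈ Set.range (κ d) ∧ f y ∈ Set.range (κ d) ∧ f u ∈ Set.range (κ d) := by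
    intro x y u hxy hxu hyu
    choose σ hσ h0 h1 h2 using fun i =>
      exists_injective_extending_triple (by omega) _ _ _ (hxy i) (hxu i) (hyu i)
    obtain ⟨d, hd⟩ := hclique (fun a => f fun i => σ i a)
      fun a b hab => hf _ _ fun i => (hσ i).ne hab
    refine ⟨d, ?_, ?_, ?_⟩
    · simpa only [h0] using hd ⟨0, by omega⟩
    · simpa only [h1] using hd ⟨1, by omega⟩
    · simpa only [h2] using hd ⟨2, by omega⟩
  have spread : ∀ d y z, (∀ i, y i ≠ z i) → f y ∈ Set.range (κ d) → f z ∈ Set.range (κ d) →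
      ∀ w, (∀ i, y i ≠ w i) → f w ∈ Set.range (κ d) := by
    intro d y z hyz hy hz w hyw
    -- The triangles `y z u` and `y w u` share the edge `y u`, and the first shares `y z` with
    -- clique `d`; hence all lie in clique `d`.
    choose u hu using fun i => exists_ne_three hr (y i) (z i) (w i)
    obtain ⟨e, he1, he2, he3⟩ := triple y z u hyz (fun i => (hu i).1.symm)
      fun i => (hu i).2.1.symm
    obtain ⟨e', he1', he2', he3'⟩ := triple y w u hyw (fun i => (hu i).1.symm)
      fun i => (hu i).2.2.symm
    obtain rfl := huniq e d _ _ (hf y z hyz).ne he1 he2 hy hz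
    obtain rfl := huniq e' e _ _ (hf y u fun i => (hu i).1.symm).ne he1' he3' he1 he3
    exact he2'
  let y : ι → Fin r := fun _ => ⟨0, by omega⟩
  let z : ι → Fin r := fun _ => ⟨1, by omega⟩
  let u : ι → Fin r := fun _ => ⟨2, by omega⟩
  obtain ⟨d, hy, hz, -⟩ := triple y z u (fun i => by simp [y, z]) (fun i => by simp [y, u])
    fun i => by simp [z, u]
  refine ⟨d, fun x => ?_⟩
  choose w hw using fun i => exists_ne_three hr (y i) (x i) (x i)
  have hwd := spread d y z (fun i => by simp [y, z]) hy hz w fun i => (hw i).1.symm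
  exact spread d w y (fun i => (hw i).1) hwd hy x fun i => (hw i).2.1

/-! ### Products of graphs covered by intersecting cliques -/

/-- Homomorphisms from a tensor product to a graph in which the `r`-cliques are few depend on a
single coordinate, when the factors are covered by pairwise intersecting `r`-cliques. -/
theorem product_hom_eq_of_coordinate {ι V W C D : Type*} [Fintype ι] {r : ℕ} (hr : 4 ≤ r)
    [Nonempty C]
    (H : SimpleGraph W) (lam : D → Fin r → W)
    (hclique : ∀ c : Fin r → W, (∀ a b, a ≠ b → H.Adj (c a) (c b)) →
      ∃ d, ∀ a, c a ∈ Set.range (lam d))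
    (huniq : ∀ d e u v, u ≠ v → u ∈ Set.range (lam d) → v ∈ Set.range (lam d) →
      u ∈ Set.range (lam e) → v ∈ Set.range (lam e) → d = e)
    (κ : C → Fin r → V) (hcover : ∀ v, ∃ c a, κ c a = v) (hmeet : ∀ c c', ∃ a b, κ c a = κ c' b)
    (f : (ι → V) → W)
    (hf : ∀ (c : ι → C) (x y : ι → Fin r), (∀ i, x i ≠ y i) →
      H.Adj (f fun i => κ (c i) (x i)) (f fun i => κ (c i) (y i))) :
    ∃ j : ι, ∀ x y, x j = y j → f x = f y := by
  classical
  have coord : ∀ c : ι → C, ∃ (j : ι) (φ : Fin r → W), Function.Injective φ ∧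
      ∀ x : ι → Fin r, f (fun i => κ (c i) (x i)) = φ (x j) := by
    intro c
    obtain ⟨d, hd⟩ := complete_power_hom_mem_clique hr H lam hclique huniq
      (fun x => f fun i => κ (c i) (x i)) (hf c)
    choose f' hf' using hd
    obtain ⟨j, σ, hσ, h⟩ := complete_power_hom hr f' fun x y hxy heq =>
      (hf c x y hxy).ne (by rw [← hf' x, ← hf' y, heq])
    refine ⟨j, fun t => lam d (σ t), fun s t hst => ?_, fun x => by rw [← hf' x, h x]⟩
    by_contra hne
    refine (hf c (fun _ => s) (fun _ => t) fun _ => hne).ne ?_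
    rw [← hf' fun _ => s, ← hf' fun _ => t, h, h]
    exact hst
  choose j φ hφ hj using coord
  have r0 : 0 < r := by omega
  have aux : ∀ c l d, j c ≠ l → j (Function.update c l d) = j c := by
    intro c l d hl
    by_contra hne
    -- With coordinate `l` held at a vertex common to both cliques, the two clique products agree.
    -- Moving coordinate `j c` changes `f` in the first description but not in the second.
    obtain ⟨a, b, hab⟩ := hmeet (c l) d
    let x : ι → Fin r := Function.update (fun _ => ⟨0, r0⟩) l a
    let x' : ι → Fin r := Function.update (fun _ => ⟨0, r0⟩) l b
    have e : ∀ u : Fin r, (fun i => κ (c i) (Function.update x (j c) u i)) =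
        fun i => κ (Function.update c l d i) (Function.update x' (j c) u i) := by
      intro u
      funext i
      by_cases hi : i = l
      · subst hi
        simp [x, x', Ne.symm hl, hab]
      · by_cases hi' : i = j c
        · subst hi'; simp [hi]
        · simp [x, x', hi, hi']
    have h0 := hj c (Function.update x (j c) ⟨0, r0⟩)
    have h1 := hj c (Function.update x (j c) ⟨1, by omega⟩)
    rw [e, hj] at h0 h1
    simp only [Function.update_self, Function.update_of_ne hne] at h0 h1
    have := hφ c (h0.symm.trans h1)
    simp at this
  have hjc : ∀ c c', j c = j c' := by
    refine fun c c' => eq_of_update_invariant j Finset.univ (fun l _ c d => ?_) c c' (by simp)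
    by_cases hl : j c = l
    · by_contra hne
      have := aux (Function.update c l d) l (c l) (by rw [← hl]; rwa [← hl] at hne)
      simp only [Function.update_idem, Function.update_eq_self] at this
      exact hne this.symm
    · exact aux c l d hl
  obtain ⟨c₀⟩ := ‹Nonempty C›
  refine ⟨j fun _ => c₀, fun x y hxy => ?_⟩
  refine eq_of_update_invariant f (Finset.univ.erase (j fun _ => c₀)) (fun l hl x v => ?_) x y
    (fun i hi => by
      have : i = j fun _ => c₀ := by simpa using hi
      rw [this, hxy])
  have hl' : l ≠ j fun _ => c₀ := by simpa using hl
  have within : ∀ (x : ι → V) (c : C) (a b : Fin r),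
      f (Function.update x l (κ c a)) = f (Function.update x l (κ c b)) := by
    intro x c a b
    choose cc s hs using fun i => hcover (x i)
    have e : ∀ a, Function.update x l (κ c a) =
        fun i => κ (Function.update cc l c i) (Function.update s l a i) := by
      intro a
      funext i
      by_cases hi : i = l
      · subst hi; simp
      · simp [hi, hs]
    rw [e a, e b, hj, hj, hjc _ fun _ => c₀, Function.update_of_ne hl'.symm,
      Function.update_of_ne hl'.symm]
  obtain ⟨c, a, hca⟩ := hcover v
  obtain ⟨c', a', hca'⟩ := hcover (x l)
  obtain ⟨b, b', hbb⟩ := hmeet c c'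
  calc f (Function.update x l v) = f (Function.update x l (κ c b)) := by rw [← hca, within]
    _ = f (Function.update x l (κ c' a')) := by rw [hbb, within]
    _ = f x := by rw [hca', Function.update_eq_self]

/-! ### The factors: three cliques in a ring -/

/-- Three cliques of order `m + 1`, any two of which share one vertex: the `d`-th clique consists of
the `d`-th row of `Fin 3 × Fin m` and the initial vertex of the next row. -/
def rowClique (m : ℕ) [NeZero m] (d : Fin 3) (a : Fin (m + 1)) : Fin 3 × Fin m :=
  if h : (a : ℕ) < m then (d, ⟨a, h⟩) else (d + 1, 0)

/-- The edges between different rows that avoid the shared vertices, directed from the `i`-th row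
to the `j`-th row. -/
def crossEdge (k : ℕ) (S : Finset ℕ) (i x j y : ℕ) : Prop :=
  x ≠ 0 ∧ y ≠ 0 ∧
    ((i = 0 ∧ (j = 1 ∨ j = 2) ∧ (x = 1 ∨ x = 2) ∧ x ≠ y) ∨
      (i = 1 ∧ j = 2 ∧ (x = 1 ∨ x = 2) ∧ x = y) ∨
      (i = 0 ∧ j = 1 ∧ 3 ≤ x ∧ x < 2 * k + 3 ∧ 2 * k + 3 ≤ y ∧
        (y < 4 * k + 2 * x + 1 ∨ (y = 4 * k + 2 * x + 1 ∧ x - 3 ∈ S))))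

/-- The edges of `cliqueRing`, directed. -/
def ringEdge (k : ℕ) (S : Finset ℕ) (i x j y : ℕ) : Prop :=
  i = j ∨ (y = 0 ∧ j = (i + 1) % 3) ∨ crossEdge k S i x j y

/-- Three cliques of order `m + 1`, any two of which share one vertex, together with edges between
them that prevent a colouring with `m + 1` colours and encode the set `S`. -/
def cliqueRing (m k : ℕ) (S : Finset ℕ) : SimpleGraph (Fin 3 × Fin m) :=
  SimpleGraph.fromRel fun u v => ringEdge k S u.1 u.2 v.1 v.2

theorem cliqueRing_adj {m k : ℕ} {S : Finset ℕ} {u v : Fin 3 × Fin m} :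
    (cliqueRing m k S).Adj u v ↔ ((u.1 : ℕ) ≠ v.1 ∨ (u.2 : ℕ) ≠ v.2) ∧
      (ringEdge k S u.1 u.2 v.1 v.2 ∨ ringEdge k S v.1 v.2 u.1 u.2) := by
  have : u ≠ v ↔ ((u.1 : ℕ) ≠ v.1 ∨ (u.2 : ℕ) ≠ v.2) := by
    rw [Ne, Prod.ext_iff, Fin.ext_iff, Fin.ext_iff]; tauto
  simp [cliqueRing, this]

/-- A necessary condition for an edge between different rows, without reference to `S`. -/
def crossBound (k i x j y : ℕ) : Prop :=
  x ≠ 0 ∧ y ≠ 0 ∧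
    ((i = 0 ∧ (j = 1 ∨ j = 2) ∧ (x = 1 ∨ x = 2) ∧ x ≠ y) ∨
      (i = 1 ∧ j = 2 ∧ (x = 1 ∨ x = 2) ∧ x = y) ∨
      (i = 0 ∧ j = 1 ∧ 3 ≤ x ∧ x < 2 * k + 3 ∧ 2 * k + 3 ≤ y ∧ y ≤ 4 * k + 2 * x + 1))

theorem crossEdge.bound {k : ℕ} {S : Finset ℕ} {i x j y : ℕ} (h : crossEdge k S i x j y) :
    crossBound k i x j y := by
  obtain ⟨hx, hy, h | h | ⟨h1, h2, h3, h4, h5, h6 | ⟨h6, -⟩⟩⟩ := h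
  · exact ⟨hx, hy, Or.inl h⟩
  · exact ⟨hx, hy, Or.inr (Or.inl h)⟩
  · exact ⟨hx, hy, Or.inr (Or.inr ⟨h1, h2, h3, h4, h5, h6.le⟩)⟩
  · exact ⟨hx, hy, Or.inr (Or.inr ⟨h1, h2, h3, h4, h5, h6.le⟩)⟩

theorem cliqueRing_adj_bound {m k : ℕ} {S : Finset ℕ} {u v : Fin 3 × Fin m}
    (h : (cliqueRing m k S).Adj u v) : ((u.1 : ℕ) ≠ v.1 ∨ (u.2 : ℕ) ≠ v.2) ∧
      ((u.1 : ℕ) = v.1 ∨ ((v.2 : ℕ) = 0 ∧ (v.1 : ℕ) = (u.1 + 1) % 3) ∨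
        ((u.2 : ℕ) = 0 ∧ (u.1 : ℕ) = (v.1 + 1) % 3) ∨
        crossBound k u.1 u.2 v.1 v.2 ∨ crossBound k v.1 v.2 u.1 u.2) := by
  obtain ⟨h1, (h | h | h) | (h | h | h)⟩ := cliqueRing_adj.1 h
  · exact ⟨h1, .inl h⟩
  · exact ⟨h1, .inr (.inl h)⟩
  · exact ⟨h1, .inr (.inr (.inr (.inl h.bound)))⟩
  · exact ⟨h1, .inl h.symm⟩
  · exact ⟨h1, .inr (.inr (.inl h))⟩
  · exact ⟨h1, .inr (.inr (.inr (.inr h.bound)))⟩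

section rowClique

variable {m : ℕ} [NeZero m]

theorem rowClique_fst_snd (d : Fin 3) (a : Fin (m + 1)) :
    ((a : ℕ) < m ∧ ((rowClique m d a).1 : ℕ) = d ∧ ((rowClique m d a).2 : ℕ) = a) ∨
      ((a : ℕ) = m ∧ ((rowClique m d a).1 : ℕ) = (d + 1) % 3 ∧ ((rowClique m d a).2 : ℕ) = 0) := by
  unfold rowClique
  split_ifs with h
  · exact Or.inl ⟨h, rfl, rfl⟩
  · refine Or.inr ⟨by omega, ?_, by simp⟩
    fin_cases d <;> rfl

theorem mem_range_rowClique {d : Fin 3} {v : Fin 3 × Fin m} :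
    v ∈ Set.range (rowClique m d) ↔
      (v.1 : ℕ) = d ∨ ((v.1 : ℕ) = (d + 1) % 3 ∧ (v.2 : ℕ) = 0) := by
  constructor
  · rintro ⟨a, rfl⟩
    have := rowClique_fst_snd d a
    omega
  · intro h
    by_cases hd : (v.1 : ℕ) = d
    · refine ⟨v.2.castSucc, Prod.ext (Fin.ext ?_) (Fin.ext ?_)⟩ <;>
      · have := rowClique_fst_snd d v.2.castSucc
        have := v.2.2
        simp only [Fin.val_castSucc] at *
        omega
    · refine ⟨Fin.last m, Prod.ext (Fin.ext ?_) (Fin.ext ?_)⟩ <;>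
      · have := rowClique_fst_snd d (Fin.last m)
        simp only [Fin.val_last] at *
        omega

theorem rowClique_adj (k : ℕ) (S : Finset ℕ) (d : Fin 3) {a b : Fin (m + 1)} (h : a ≠ b) :
    (cliqueRing m k S).Adj (rowClique m d a) (rowClique m d b) := by
  have ha := rowClique_fst_snd d a
  have hb := rowClique_fst_snd d b
  have := d.2
  rw [Ne, Fin.ext_iff] at h
  refine cliqueRing_adj.2 ⟨by omega, ?_⟩
  rcases ha with ha | ha <;> rcases hb with hb | hb
  · exact .inl (.inl (by omega))
  · exact .inl (.inr (.inl (by omega)))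
  · exact .inr (.inr (.inl (by omega)))
  · omega

theorem rowClique_unique (d e : Fin 3) (u v : Fin 3 × Fin m) (huv : u ≠ v)
    (h1 : u ∈ Set.range (rowClique m d)) (h2 : v ∈ Set.range (rowClique m d))
    (h3 : u ∈ Set.range (rowClique m e)) (h4 : v ∈ Set.range (rowClique m e)) : d = e := by
  rw [mem_range_rowClique] at h1 h2 h3 h4
  rw [Ne, Prod.ext_iff, Fin.ext_iff, Fin.ext_iff] at huv
  have := d.2
  have := e.2
  apply Fin.ext
  omega

theorem rowClique_cover (v : Fin 3 × Fin m) : ∃ d a, rowClique m d a = v :=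
  ⟨v.1, mem_range_rowClique.2 (.inl rfl)⟩

theorem rowClique_meet (d e : Fin 3) : ∃ a b, rowClique m d a = rowClique m e b := by
  have key : ∃ v : Fin 3 × Fin m, v ∈ Set.range (rowClique m d) ∧
      v ∈ Set.range (rowClique m e) := by
    simp only [mem_range_rowClique]
    by_cases h : (e : ℕ) = (d + 1) % 3
    · exact ⟨(e, 0), by simp [h]⟩
    · have := d.2
      have := e.2
      refine ⟨(d, 0), by simp, ?_⟩
      simp only [Fin.val_zero, and_true]
      omega
  obtain ⟨v, ⟨a, ha⟩, b, hb⟩ := key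
  exact ⟨a, b, ha.trans hb.symm⟩

/-- Every clique of order `m + 1` of `cliqueRing` is one of the three given ones. -/
theorem cliqueRing_clique {k : ℕ} {S : Finset ℕ} (hm : 4 ≤ m) (c : Fin (m + 1) → Fin 3 × Fin m)
    (hc : ∀ a b, a ≠ b → (cliqueRing m k S).Adj (c a) (c b)) :
    ∃ d, ∀ a, c a ∈ Set.range (rowClique m d) := by
  have hinj : Function.Injective c := fun a b hab => by
    by_contra hne
    exact (hc a b hne).ne hab
  have hb : ∀ a b, a ≠ b → _ := fun a b hab => cliqueRing_adj_bound (hc a b hab)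
  simp only [crossBound] at hb
  have hrow : ∀ a, ((c a).1 : ℕ) < 3 := fun a => (c a).1.2
  -- Pigeonhole: `m + 1` vertices occupy `m` positions.
  obtain ⟨s, t, hst, hne⟩ : ∃ s t, ((c s).2 : ℕ) = (c t).2 ∧ s ≠ t := by
    by_contra hcon
    push Not at hcon
    have := Fintype.card_le_of_injective (fun a => (c a).2)
      fun a b hab => hcon a b (congrArg Fin.val hab)
    simp at this
  by_cases h0 : ((c s).2 : ℕ) = 0
  · by_cases hall : ∀ a, ((c a).2 : ℕ) = 0
    · exfalso
      have := Fintype.card_le_of_injective (fun a => (c a).1) fun a b hab =>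
        hinj (Prod.ext hab (Fin.ext ((hall a).trans (hall b).symm)))
      simp at this
      omega
    push Not at hall
    obtain ⟨a₀, ha₀⟩ := hall
    -- A shared vertex is adjacent to unshared ones only in its own and the preceding row, so two
    -- shared vertices determine the row of every unshared member.
    refine ⟨(c a₀).1, fun a => mem_range_rowClique.2 ?_⟩
    have hsa : s ≠ a₀ := by rintro rfl; exact ha₀ h0
    have hta : t ≠ a₀ := by rintro rfl; exact ha₀ (hst ▸ h0)
    have hhub : ∀ p q, p ≠ q → ((c p).2 : ℕ) = 0 → ((c p).1 : ℕ) ≠ (c q).1 ∨ ((c q).2 : ℕ) ≠ 0 :=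
      fun p q hpq hp => by have := (hb p q hpq).1; omega
    have hnbr : ∀ p q, p ≠ q → ((c p).2 : ℕ) = 0 → ((c q).2 : ℕ) ≠ 0 →
        ((c p).1 : ℕ) = (c q).1 ∨ ((c p).1 : ℕ) = ((c q).1 + 1) % 3 :=
      fun p q hpq hp hq => by have := (hb p q hpq).2; omega
    have h1 := hhub s t hne h0
    have h2 := hnbr s a₀ hsa h0 ha₀
    have h3 := hnbr t a₀ hta (hst ▸ h0) ha₀
    have r3 := hrow a₀
    have r4 := hrow a
    by_cases hz : ((c a).2 : ℕ) = 0
    · have h4 := hnbr a a₀ (by rintro rfl; exact ha₀ hz) hz ha₀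
      omega
    · have h4 := hnbr s a (by rintro rfl; exact hz h0) h0 hz
      have h5 := hnbr t a (by rintro rfl; exact hz (hst ▸ h0)) (hst ▸ h0) hz
      omega
  · exfalso
    have h1 := hb s t hne
    have r1 := hrow s
    have r2 := hrow t
    -- Away from position `0`, equal positions are adjacent only in rows `1` and `2`, at position
    -- `1` or `2`. Such an edge has just two possible common neighbours, too few for `m + 1 ≥ 5`
    -- vertices.
    have e : ∃ s t, s ≠ t ∧ ((c s).1 : ℕ) = 1 ∧ ((c t).1 : ℕ) = 2 ∧
        ((c s).2 : ℕ) = (c t).2 ∧ (((c s).2 : ℕ) = 1 ∨ ((c s).2 : ℕ) = 2) := by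
      by_cases h : ((c s).1 : ℕ) = 1
      · exact ⟨s, t, hne, by omega⟩
      · exact ⟨t, s, hne.symm, by omega⟩
    clear h1 r1 r2 hst hne h0
    obtain ⟨s, t, hne, hs1, ht1, hst, hs2⟩ := e
    have hcode : ∀ a, a = s ∨ a = t ∨ (((c a).1 : ℕ) = 0 ∧ ((c a).2 : ℕ) = 3 - (c s).2) ∨
        (((c a).1 : ℕ) = 2 ∧ ((c a).2 : ℕ) = 0) := by
      intro a
      by_cases h5 : a = s
      · exact .inl h5
      by_cases h6 : a = t
      · exact .inr (.inl h6)
      have r4 := hrow a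
      have h8 := hb s a (Ne.symm h5)
      have h9 := hb t a (Ne.symm h6)
      omega
    have hcard : (Finset.univ : Finset (Fin (m + 1))).card ≤
        ({c s, c t, ((0 : Fin 3), (⟨3 - (c s).2, by omega⟩ : Fin m)), ((2 : Fin 3), 0)} :
          Finset (Fin 3 × Fin m)).card := by
      refine Finset.card_le_card_of_injOn c (fun a _ => ?_) hinj.injOn
      simp only [Finset.coe_insert, Finset.coe_singleton, Set.mem_insert_iff,
        Set.mem_singleton_iff]
      rcases hcode a with rfl | rfl | h | h
      · simp
      · simp
      · refine .inr (.inr (.inl (Prod.ext (Fin.ext h.1) (Fin.ext h.2))))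
      · refine .inr (.inr (.inr (Prod.ext (Fin.ext h.1) (Fin.ext (by simpa using h.2)))))
    have := hcard.trans Finset.card_le_four
    simp at this
    omega

/-- Each clique maps onto a clique. If two had the same image, so would the third, giving a
colouring with `m + 1` colours; the cross edges at positions `1` and `2` rule this out. So the
cliques are permuted, the map is onto, and finiteness gives injectivity. -/
theorem cliqueRing_hom_injective {k : ℕ} {S T : Finset ℕ} (hm : 4 ≤ m)
    (g : cliqueRing m k S →g cliqueRing m k T) : Function.Injective g := by
  have hmem : ∀ d, ∃ e, ∀ a, g (rowClique m d a) ∈ Set.range (rowClique m e) := fun d =>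
    cliqueRing_clique hm _ fun a b hab => g.map_adj (rowClique_adj k S d hab)
  choose e he using hmem
  have hmem : ∀ d v, v ∈ Set.range (rowClique m d) → g v ∈ Set.range (rowClique m (e d)) := by
    rintro d _ ⟨a, rfl⟩
    exact he d a
  have honto : ∀ d w, w ∈ Set.range (rowClique m (e d)) →
      ∃ v ∈ Set.range (rowClique m d), g v = w := by
    rintro d _ ⟨b, rfl⟩
    choose h hh using he d
    have hinj : Function.Injective h := fun x y hxy => by
      by_contra hne
      refine (g.map_adj (rowClique_adj k S d hne)).ne ?_
      rw [← hh x, ← hh y, hxy]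
    obtain ⟨a, ha⟩ := Finite.injective_iff_surjective.1 hinj b
    exact ⟨rowClique m d a, ⟨a, rfl⟩, by rw [← hh a, ha]⟩
  have hthird : ∀ d d' d'' : Fin 3, d ≠ d' → d ≠ d'' → d' ≠ d'' → e d = e d' → e d'' = e d := by
    intro d d' d'' h1 h2 h3 hee
    obtain ⟨a, b, hab⟩ := rowClique_meet (m := m) d d''
    obtain ⟨a', b', hab'⟩ := rowClique_meet (m := m) d' d''
    have hbb : b ≠ b' := by
      rintro rfl
      have ha := rowClique_fst_snd d a
      have ha' := rowClique_fst_snd d' a'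
      have hb := rowClique_fst_snd d'' b
      rw [hab] at ha
      rw [hab'] at ha'
      rw [Ne, Fin.ext_iff] at h1 h2 h3
      omega
    refine rowClique_unique _ _ _ _ (g.map_adj (rowClique_adj k S d'' hbb)).ne (he _ _) (he _ _)
      ?_ ?_
    · rw [← hab]; exact he _ _
    · rw [← hab', hee]; exact he _ _
  have heinj : Function.Injective e := by
    intro d d' hee
    by_contra hne
    have hall : ∀ d'', e d'' = e d := by
      intro d''
      by_cases h1 : d = d''
      · rw [h1]
      by_cases h2 : d' = d''
      · rw [← h2, hee]
      exact hthird d d' d'' hne h1 h2 hee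
    -- two adjacent vertices would have the same colour as the vertex shared by two cliques
    have hcol : ∀ x : Fin m, ((x : ℕ) = 1 ∨ (x : ℕ) = 2) → g (0, x) = g (2, 0) := by
      intro x hx
      have h0 := hmem 0 (0, x) (mem_range_rowClique.2 (.inl rfl))
      rw [hall 0, ← hall 1] at h0
      obtain ⟨u, hu, hgu⟩ := honto 1 _ h0
      rw [hall 1, ← hall 2] at h0
      obtain ⟨v, hv, hgv⟩ := honto 2 _ h0
      rw [mem_range_rowClique] at hu hv
      have hu' : ¬ (cliqueRing m k S).Adj (0, x) u := fun h => (g.map_adj h).ne hgu.symm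
      have hv' : ¬ (cliqueRing m k S).Adj (0, x) v := fun h => (g.map_adj h).ne hgv.symm
      have huv : ¬ (cliqueRing m k S).Adj u v := fun h =>
        (g.map_adj h).ne (hgu.trans hgv.symm)
      simp only [cliqueRing_adj, ringEdge, crossEdge] at hu' hv' huv
      simp only [Fin.val_zero, Fin.val_one, Fin.val_two] at hu hv hu' hv'
      -- Non-adjacency to `(0, x)` leaves `u` only `(1, x)` or `(2, 0)`, and `v` only `(2, x)` or
      -- `(2, 0)`; but `(1, x)` and `(2, x)` are adjacent.
      by_cases hu2 : (u.1 : ℕ) = 2 ∧ (u.2 : ℕ) = 0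
      · rw [← hgu]
        exact congrArg g (Prod.ext (Fin.ext hu2.1) (Fin.ext (by simpa using hu2.2)))
      · by_cases hv2 : (v.1 : ℕ) = 2 ∧ (v.2 : ℕ) = 0
        · rw [← hgv]
          exact congrArg g (Prod.ext (Fin.ext hv2.1) (Fin.ext (by simpa using hv2.2)))
        · exfalso
          grind
    have h1 := hcol ⟨1, by omega⟩ (.inl rfl)
    have h2 := hcol ⟨2, by omega⟩ (.inr rfl)
    refine (g.map_adj (v := (0, ⟨1, by omega⟩)) (w := (0, ⟨2, by omega⟩)) ?_).ne (h1.trans h2.symm)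
    simp [cliqueRing_adj, ringEdge]
  have hsurj : Function.Surjective g := by
    intro w
    obtain ⟨d, a, hd⟩ := rowClique_cover w
    obtain ⟨d', rfl⟩ := Finite.injective_iff_surjective.1 heinj d
    obtain ⟨v, -, hv⟩ := honto d' w ⟨a, hd⟩
    exact ⟨v, hv⟩
  exact Finite.injective_iff_surjective.2 hsurj

end rowClique

/-! ### Degrees recover the label set -/

open Classical in
/-- A vertex together with its neighbours. -/
noncomputable def closedNeighbors {V : Type*} [Fintype V] (G : SimpleGraph V) (v : V) : Finset V :=
  Finset.univ.filter fun w => w = v ∨ G.Adj v w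

theorem mem_closedNeighbors {V : Type*} [Fintype V] {G : SimpleGraph V} {v w : V} :
    w ∈ closedNeighbors G v ↔ w = v ∨ G.Adj v w := by
  simp [closedNeighbors]

theorem card_closedNeighbors_le {V W : Type*} [Fintype V] [Fintype W] {G : SimpleGraph V}
    {H : SimpleGraph W} (g : G →g H) (hg : Function.Injective g) (v : V) :
    (closedNeighbors G v).card ≤ (closedNeighbors H (g v)).card := by
  refine Finset.card_le_card_of_injOn g (fun w hw => ?_) hg.injOn
  rw [Finset.mem_coe, mem_closedNeighbors] at *
  exact hw.imp (congrArg g) g.map_adj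

/-- The part of a row with positions from `a` to `b - 1`. -/
def rowSegment (m : ℕ) (i : Fin 3) (a b : ℕ) : Finset (Fin 3 × Fin m) :=
  {i} ×ˢ Finset.univ.filter fun x : Fin m => a ≤ (x : ℕ) ∧ (x : ℕ) < b

theorem mem_rowSegment {m : ℕ} {i : Fin 3} {a b : ℕ} {v : Fin 3 × Fin m} :
    v ∈ rowSegment m i a b ↔ (v.1 : ℕ) = i ∧ a ≤ (v.2 : ℕ) ∧ (v.2 : ℕ) < b := by
  rw [rowSegment, Finset.mem_product]
  simp [Fin.ext_iff]

theorem card_rowSegment {m : ℕ} (i : Fin 3) {a b : ℕ} (hb : b ≤ m) :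
    (rowSegment m i a b).card = b - a := by
  rw [rowSegment, Finset.card_product, Finset.card_singleton, one_mul, ← Nat.card_Ico,
    ← Finset.card_map Fin.valEmbedding]
  congr 1
  ext x
  simp only [Finset.mem_map, Finset.mem_filter, Finset.mem_univ, true_and, Fin.valEmbedding_apply,
    Finset.mem_Ico]
  constructor
  · rintro ⟨y, hy, rfl⟩; exact hy
  · intro h; exact ⟨⟨x, by omega⟩, h, rfl⟩

theorem disjoint_rowSegment {m : ℕ} {i j : Fin 3} {a b a' b' : ℕ} (h : i ≠ j ∨ b ≤ a') :
    Disjoint (rowSegment m i a b) (rowSegment m j a' b') := by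
  rw [Finset.disjoint_left]
  intro v hv hv'
  rw [mem_rowSegment] at hv hv'
  rw [Ne, Fin.ext_iff] at h
  omega

theorem card_closedNeighbors_of_shared {m k : ℕ} {S : Finset ℕ} (v : Fin 3 × Fin m)
    (hv : (v.2 : ℕ) = 0) : 2 * m ≤ (closedNeighbors (cliqueRing m k S) v).card := by
  calc 2 * m = (rowSegment m v.1 0 m ∪ rowSegment m (v.1 + 2) 0 m).card := by
        rw [Finset.card_union_of_disjoint (disjoint_rowSegment
            (.inl (by generalize v.1 = i; revert i; decide))), card_rowSegment _ le_rfl, card_rowSegment _ le_rfl]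
        omega
    _ ≤ _ := by
        refine Finset.card_le_card fun w hw => ?_
        have e : ((v.1 + 2 : Fin 3) : ℕ) = (v.1 + 2) % 3 := by
          generalize v.1 = i; revert i; decide
        rw [Finset.mem_union, mem_rowSegment, mem_rowSegment, e] at hw
        rw [mem_closedNeighbors, Prod.ext_iff, Fin.ext_iff, Fin.ext_iff, cliqueRing_adj]
        have := v.1.2
        by_cases h : (w.1 : ℕ) = v.1
        · by_cases h' : (w.2 : ℕ) = v.2
          · exact .inl ⟨h, h'⟩
          · exact .inr ⟨by omega, .inl (.inl h.symm)⟩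
        · exact .inr ⟨by omega, .inr (.inr (.inl ⟨hv, by omega⟩))⟩

theorem card_closedNeighbors_of_first {m k : ℕ} {S : Finset ℕ} (hm : 3 ≤ m) (v : Fin 3 × Fin m)
    (hv : (v.1 : ℕ) = 0) (hv' : (v.2 : ℕ) = 1 ∨ (v.2 : ℕ) = 2) :
    2 * m - 3 ≤ (closedNeighbors (cliqueRing m k S) v).card := by
  calc 2 * m - 3 = (rowSegment m 0 0 m ∪ rowSegment m 1 3 m).card := by
        rw [Finset.card_union_of_disjoint (disjoint_rowSegment (.inl (by decide))),
          card_rowSegment _ le_rfl, card_rowSegment _ le_rfl]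
        omega
    _ ≤ _ := by
        refine Finset.card_le_card fun w hw => ?_
        rw [Finset.mem_union, mem_rowSegment, mem_rowSegment, Fin.val_zero, Fin.val_one] at hw
        rw [mem_closedNeighbors, Prod.ext_iff, Fin.ext_iff, Fin.ext_iff, cliqueRing_adj]
        by_cases h : (w.1 : ℕ) = v.1
        · by_cases h' : (w.2 : ℕ) = v.2
          · exact .inl ⟨h, h'⟩
          · exact .inr ⟨by omega, .inl (.inl h.symm)⟩
        · refine .inr ⟨by omega, .inl (.inr (.inr ⟨by omega, by omega, .inl ?_⟩))⟩
          omega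

/-- With `b` maximal, the label vertex of `s`, at position `s + 3`, is credited with `m + 2k + 5 +
2s` closed neighbours, and one more if `s ∈ S`. The spacing of `2` keeps the labels ordered whatever
`S` is. -/
theorem card_closedNeighbors_of_label {m k : ℕ} {S : Finset ℕ} (v : Fin 3 × Fin m)
    (hv : (v.1 : ℕ) = 0) (hv' : 3 ≤ (v.2 : ℕ)) (hv2 : (v.2 : ℕ) < 2 * k + 3) (b : ℕ)
    (hb : b ≤ m) (hb' : 2 * k + 3 ≤ b)
    (hS : b ≤ 4 * k + 2 * v.2 + 1 ∨ (b ≤ 4 * k + 2 * v.2 + 2 ∧ (v.2 : ℕ) - 3 ∈ S)) :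
    m + 1 + (b - (2 * k + 3)) ≤ (closedNeighbors (cliqueRing m k S) v).card := by
  calc m + 1 + (b - (2 * k + 3)) =
        (rowSegment m 0 0 m ∪ (rowSegment m 1 0 1 ∪ rowSegment m 1 (2 * k + 3) b)).card := by
        rw [Finset.card_union_of_disjoint (Finset.disjoint_union_right.2
            ⟨disjoint_rowSegment (.inl (by decide)), disjoint_rowSegment (.inl (by decide))⟩),
          Finset.card_union_of_disjoint (disjoint_rowSegment (.inr (by omega))),
          card_rowSegment _ le_rfl, card_rowSegment _ (by omega), card_rowSegment _ hb]
        omega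
    _ ≤ _ := by
        refine Finset.card_le_card fun w hw => ?_
        simp only [Finset.mem_union, mem_rowSegment, Fin.val_zero, Fin.val_one] at hw
        rw [mem_closedNeighbors, Prod.ext_iff, Fin.ext_iff, Fin.ext_iff, cliqueRing_adj]
        by_cases h : (w.1 : ℕ) = v.1
        · by_cases h' : (w.2 : ℕ) = v.2
          · exact .inl ⟨h, h'⟩
          · exact .inr ⟨by omega, .inl (.inl h.symm)⟩
        · refine .inr ⟨by omega, .inl ?_⟩
          by_cases h0 : (w.2 : ℕ) = 0
          · exact .inr (.inl ⟨h0, by omega⟩)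
          · refine .inr (.inr ⟨by omega, h0, .inr (.inr ⟨hv, by omega, hv', hv2, by omega, ?_⟩)⟩)
            rcases hS with hS | ⟨hS, hmem⟩
            · exact .inl (by omega)
            · by_cases h : (w.2 : ℕ) = 4 * k + 2 * v.2 + 1
              · exact .inr ⟨h, hmem⟩
              · exact .inl (by omega)

/-- The vertices of large degree, up to the label of `s`. -/
def heavyVertices (m k s : ℕ) : Finset (Fin 3 × Fin m) :=
  Finset.univ.filter fun v => (v.2 : ℕ) = 0 ∨
    ((v.1 : ℕ) = 0 ∧ ((v.2 : ℕ) = 1 ∨ (v.2 : ℕ) = 2 ∨ (s + 3 < (v.2 : ℕ) ∧ (v.2 : ℕ) < 2 * k + 3)))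

/-- The threshold is what the label vertex of `s` attains when `s` is in the label set; when it is
not, that vertex falls one short. -/
theorem card_closedNeighbors_lt {m k s : ℕ} {T : Finset ℕ} (hm : 16 * k + 4 ≤ m)
    (hs : s < 2 * k) (hT : s ∉ T) (v : Fin 3 × Fin m) (hv : v ∉ heavyVertices m k s) :
    (closedNeighbors (cliqueRing m k T) v).card < m + 2 * k + 6 + 2 * s := by
  have hv' := hv
  simp only [heavyVertices, Finset.mem_filter, Finset.mem_univ, true_and] at hv'
  have hrow := v.1.2
  have hcases : (v.1 : ℕ) = 0 ∨ (v.1 : ℕ) = 1 ∨ (v.1 : ℕ) = 2 := by omega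
  obtain ⟨i, j, l, l', p, q, p', q', hsub, hq, hq', hle⟩ : ∃ (i j l l' : Fin 3) (p q p' q' : ℕ),
      closedNeighbors (cliqueRing m k T) v ⊆
        rowSegment m i 0 m ∪ rowSegment m j 0 1 ∪ rowSegment m l p q ∪ rowSegment m l' p' q' ∧
      q ≤ m ∧ q' ≤ m ∧ m + 1 + (q - p) + (q' - p') < m + 2 * k + 6 + 2 * s := by
    rcases hcases with h | h | h
    · refine ⟨0, 1, 1, 1, 2 * k + 3, 4 * k + 2 * (s + 3) + 1, 0, 0, fun w hw => ?_, by omega,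
        by omega, by omega⟩
      rw [mem_closedNeighbors] at hw
      simp only [Finset.mem_union, mem_rowSegment, Fin.val_zero, Fin.val_one]
      have := w.2.2
      rcases hw with rfl | hw
      · omega
      · obtain ⟨-, hw⟩ := cliqueRing_adj.1 hw
        by_cases h4 : (v.2 : ℕ) = s + 3
        · rw [← Nat.add_sub_cancel (n := s) (m := 3), ← h4] at hT
          simp only [ringEdge, crossEdge, hT, and_false, or_false] at hw
          omega
        · rcases hw with (hw | hw | hw) | (hw | hw | hw)
          · omega
          · omega
          · have := hw.bound
            simp only [crossBound] at this
            omega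
          · omega
          · omega
          · have := hw.bound
            simp only [crossBound] at this
            omega
    · refine ⟨1, 2, 0, 2, 1, 2 * k + 3, v.2, v.2 + 1, fun w hw => ?_, by omega, v.2.2, by omega⟩
      rw [mem_closedNeighbors] at hw
      simp only [Finset.mem_union, mem_rowSegment, Fin.val_zero, Fin.val_one, Fin.val_two]
      have := w.2.2
      rcases hw with rfl | hw
      · omega
      · obtain ⟨-, hw⟩ := cliqueRing_adj_bound hw
        simp only [crossBound] at hw
        omega
    · refine ⟨2, 0, 0, 1, 1, 3, v.2, v.2 + 1, fun w hw => ?_, by omega, v.2.2, by omega⟩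
      rw [mem_closedNeighbors] at hw
      simp only [Finset.mem_union, mem_rowSegment, Fin.val_zero, Fin.val_one, Fin.val_two]
      have := w.2.2
      rcases hw with rfl | hw
      · omega
      · obtain ⟨-, hw⟩ := cliqueRing_adj_bound hw
        simp only [crossBound] at hw
        omega
  refine (Finset.card_le_card hsub).trans_lt (lt_of_le_of_lt ?_ hle)
  refine (Finset.card_union_le _ _).trans (Nat.add_le_add ?_ (card_rowSegment _ hq').le)
  refine (Finset.card_union_le _ _).trans (Nat.add_le_add ?_ (card_rowSegment _ hq).le)
  refine (Finset.card_union_le _ _).trans (Nat.add_le_add (card_rowSegment _ le_rfl).le ?_)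
  exact (card_rowSegment _ (by omega)).le

theorem cliqueRing_subset_of_hom {m k : ℕ} [NeZero m] {S T : Finset ℕ} (hm : 16 * k + 4 ≤ m)
    (hS : S ⊆ Finset.range (2 * k)) (g : cliqueRing m k S →g cliqueRing m k T) : S ⊆ T := by
  intro s hs
  have hsk := Finset.mem_range.1 (hS hs)
  by_contra hT
  have hinj := cliqueRing_hom_injective (by omega) g
  let p : Fin 3 × Fin m := (0, ⟨s + 3, by omega⟩)
  have hp : p ∉ heavyVertices m k s := by simp [p, heavyVertices]
  -- In the source `p` and all heavy vertices reach the threshold, while in the target only heavy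
  -- vertices can. Injectivity would then fit one vertex too many into the heavy set.
  have hcard := Finset.card_le_card_of_injOn (s := insert p (heavyVertices m k s))
    (t := heavyVertices m k s) g (fun v hv => ?_) hinj.injOn
  · rw [Finset.card_insert_of_notMem hp] at hcard
    omega
  · by_contra hgv
    have h1 := card_closedNeighbors_lt hm hsk hT _ hgv
    have h2 := card_closedNeighbors_le g hinj v
    have h3 : m + 2 * k + 6 + 2 * s ≤ (closedNeighbors (cliqueRing m k S) v).card := by
      rw [Finset.mem_coe, Finset.mem_insert] at hv
      rcases hv with rfl | hv
      · refine le_trans ?_ (card_closedNeighbors_of_label p rfl (by simp [p])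
          (by simp only [p]; omega) (4 * k + 2 * (s + 3) + 2) (by omega) (by omega)
          (.inr ⟨le_rfl, by simpa [p] using hs⟩))
        omega
      · simp only [heavyVertices, Finset.mem_filter, Finset.mem_univ, true_and] at hv
        rcases hv with h | ⟨h, h' | h' | h'⟩
        · exact le_trans (by omega) (card_closedNeighbors_of_shared v h)
        · exact le_trans (by omega) (card_closedNeighbors_of_first (by omega) v h (.inl h'))
        · exact le_trans (by omega) (card_closedNeighbors_of_first (by omega) v h (.inr h'))
        · refine le_trans ?_ (card_closedNeighbors_of_label v h (by omega) h'.2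
            (4 * k + 2 * v.2 + 1) (by omega) (by omega) (.inl le_rfl))
          omega
    omega

/-! ### Endomorphisms of the product and its core -/

theorem cliqueRing_product_hom {ι : Type*} [Finite ι] {m k : ℕ} [NeZero m] (hm : 4 ≤ m)
    (S : ι → Finset ℕ) (T : Finset ℕ) (f : (ι → Fin 3 × Fin m) → Fin 3 × Fin m)
    (hf : ∀ x y, (∀ i, (cliqueRing m k (S i)).Adj (x i) (y i)) →
      (cliqueRing m k T).Adj (f x) (f y)) :
    ∃ (j : ι) (g : cliqueRing m k (S j) →g cliqueRing m k T), ∀ x, f x = g (x j) := by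
  classical
  have := Fintype.ofFinite ι
  obtain ⟨j, hj⟩ := product_hom_eq_of_coordinate (r := m + 1) (by omega) (cliqueRing m k T)
    (rowClique m) (fun c hc => cliqueRing_clique hm c hc) rowClique_unique (rowClique m)
    rowClique_cover rowClique_meet f
    fun c x y hxy => hf _ _ fun i => rowClique_adj k (S i) (c i) (hxy i)
  have hedge : ∀ i, (cliqueRing m k (S i)).Adj (rowClique m 0 0) (rowClique m 0 1) := fun i =>
    rowClique_adj k (S i) 0 (by simp)
  refine ⟨j, ⟨fun v => f fun _ => v, fun {u v} huv => ?_⟩, fun x => hj _ _ rfl⟩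
  -- An edge `u v` of factor `j` extends to an edge of the product by a fixed edge in each other
  -- factor.
  have h := hf (Function.update (fun _ => rowClique m 0 0) j u)
    (Function.update (fun _ => rowClique m 0 1) j v) fun i => by
      by_cases hi : i = j
      · subst hi; simpa using huv
      · simpa [hi] using hedge i
  rwa [hj _ (fun _ => u) (by simp), hj (Function.update _ j v) (fun _ => v) (by simp)] at h

theorem cliqueRing_product_hom_injective {ι : Type*} [Finite ι] [Nonempty ι] {m k : ℕ} [NeZero m]
    (hm : 16 * k + 4 ≤ m) (S : ι → Finset ℕ) (hS : ∀ i, S i ⊆ Finset.range (2 * k))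
    (hanti : ∀ i j, S i ⊆ S j → i = j)
    (f : tensorProduct (fun i => cliqueRing m k (S i)) →g
      tensorProduct fun i => cliqueRing m k (S i)) : Function.Injective f := by
  intro x y hxy
  funext i
  obtain ⟨j, g, hg⟩ := cliqueRing_product_hom (by omega) S (S i) (fun x => f x i)
    fun x y h => f.map_adj (v := x) (w := y) h i
  obtain rfl := hanti j i (cliqueRing_subset_of_hom hm (hS j) g)
  refine cliqueRing_hom_injective (by omega) g ?_
  rw [← hg, ← hg, hxy]

/-- Relabelling the factors relabels the tensor product. -/
def tensorProductIso {ι : Type*} [Nonempty ι] {V W : ι → Type*} {G : ∀ i, SimpleGraph (V i)}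
    {H : ∀ i, SimpleGraph (W i)} (e : ∀ i, G i ≃g H i) : tensorProduct G ≃g tensorProduct H where
  toEquiv := Equiv.piCongrRight fun i => (e i).toEquiv
  map_rel_iff' {_ _} := forall_congr' fun i => (e i).map_rel_iff

/-- A finite graph all of whose endomorphisms are injective is its own core. -/
theorem exists_core_of_endomorphism_injective {V : Type*} [Fintype V] (G : SimpleGraph V)
    (h : ∀ f : G →g G, Function.Injective f) :
    ∃ C : SimpleGraph (Fin (Fintype.card V)), IsCoreOf C G := by
  let e := G.overFinIso (rfl : Fintype.card V = Fintype.card V)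
  refine ⟨_, ⟨⟨e.symm.toHom⟩, ⟨e.toHom⟩⟩, fun m H => ?_⟩
  rintro ⟨⟨p⟩, ⟨q⟩⟩
  have hinj : Function.Injective q := Function.Injective.of_comp (f := p) (h (p.comp q))
  simpa using Fintype.card_le_of_injective q hinj

/-- For `k ≥ 2` the ratio of the bases is at least `13/10` and the exponent at least `6`, while
`(13/10)^6 > 4`. For `k = 0` this is `8 < 12`; for `k = 1` it fails. -/
theorem four_mul_pow_lt {k : ℕ} (hk : k ≠ 1) :
    4 * (16 * k ^ 2 + 80 * k + 2) ^ (2 * k).choose k <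
      (3 * (16 * k ^ 2 + 16 * k + 4)) ^ (2 * k).choose k := by
  obtain rfl | hk2 : k = 0 ∨ 2 ≤ k := by omega
  · simp
  set N := (2 * k).choose k
  set a := 16 * k ^ 2 + 80 * k + 2
  set b := 3 * (16 * k ^ 2 + 16 * k + 4)
  have hN : 6 ≤ N := by
    have h1 : (4 : ℕ).choose 2 ≤ Nat.choose (2 * k) 2 := Nat.choose_le_choose 2 (by omega)
    have h2 : Nat.choose (2 * k) 2 ≤ N := by
      have := Nat.choose_le_centralBinom 2 k
      rwa [Nat.centralBinom_eq_two_mul_choose] at this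
    exact le_trans (by decide) (h1.trans h2)
  have hab : 13 * a ≤ 10 * b := by
    simp only [a, b]
    nlinarith
  have ha : 0 < a := by simp only [a]; positivity
  have h1 : 13 ^ N * a ^ N ≤ 10 ^ N * b ^ N := by
    rw [← mul_pow, ← mul_pow]
    exact Nat.pow_le_pow_left hab N
  have h2 : 4 * 10 ^ N < 13 ^ N := by
    obtain ⟨t, ht⟩ := Nat.exists_eq_add_of_le hN
    rw [ht, pow_add, pow_add]
    have : 10 ^ t ≤ 13 ^ t := Nat.pow_le_pow_left (by norm_num) t
    have : 0 < 10 ^ t := by positivity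
    omega
  have h3 : 10 ^ N * (4 * a ^ N) < 10 ^ N * b ^ N := by
    refine lt_of_lt_of_le ?_ h1
    calc 10 ^ N * (4 * a ^ N) = 4 * 10 ^ N * a ^ N := by ring
      _ < 13 ^ N * a ^ N := Nat.mul_lt_mul_of_pos_right h2 (by positivity)
  exact Nat.lt_of_mul_lt_mul_left h3

theorem mainTheorem6 (k : ℕ) (hk : k ≠ 1) :
    ∃ (n : Fin ((2 * k).choose k) → ℕ) (G : ∀ i, SimpleGraph (Fin (n i))),
      (∀ i, 16 * k ^ 2 + 80 * k + 12 ≤ n i ∧ n i ≤ 48 * k ^ 2 + 48 * k + 12) ∧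
      (∀ i j, i ≠ j → IsEmpty (G i ≃g G j)) ∧
      ∃ (m : ℕ) (C : SimpleGraph (Fin m)), IsCoreOf C (tensorProduct G) ∧
        4 * (16 * k ^ 2 + 80 * k + 2) ^ ((2 * k).choose k) < m := by
  -- Chosen so that `3 * M` is exactly the permitted maximum of vertices.
  set M := 16 * k ^ 2 + 16 * k + 4 with hM
  have hm : 16 * k + 4 ≤ M := by omega
  have : NeZero M := ⟨by omega⟩
  have hcard : ((Finset.range (2 * k)).powersetCard k).card = (2 * k).choose k := by simp
  let label := (Finset.equivFinOfCardEq hcard).symm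
  let S : Fin ((2 * k).choose k) → Finset ℕ := fun i => label i
  have hS : ∀ i, S i ⊆ Finset.range (2 * k) ∧ (S i).card = k := fun i =>
    Finset.mem_powersetCard.1 (label i).2
  have hanti : ∀ i j, S i ⊆ S j → i = j := fun i j hij =>
    label.injective (Subtype.ext (Finset.eq_of_subset_of_card_le hij
      (by rw [(hS i).2, (hS j).2])))
  have hV : Fintype.card (Fin 3 × Fin M) = 3 * M := by simp
  let e := fun i => (cliqueRing M k (S i)).overFinIso hV
  refine ⟨fun _ => 3 * M, fun i => (cliqueRing M k (S i)).overFin hV, fun _ => ⟨?_, ?_⟩,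
    fun i j hij => ⟨fun φ => hij (hanti i j ?_)⟩, ?_⟩
  · change _ ≤ 3 * M
    obtain rfl | hk2 : k = 0 ∨ 2 ≤ k := by omega
    · omega
    · nlinarith
  · change 3 * M ≤ _
    omega
  · exact cliqueRing_subset_of_hom hm (hS i).1
      (SimpleGraph.Iso.toHom (((e i).trans φ).trans (e j).symm))
  · let E := tensorProductIso e
    obtain ⟨C, hC⟩ := exists_core_of_endomorphism_injective
      (tensorProduct fun i => (cliqueRing M k (S i)).overFin hV) fun f x y hxy => by
        have h := cliqueRing_product_hom_injective hm S (fun i => (hS i).1) hanti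
          ((E.symm.toHom.comp f).comp E.toHom)
        have := @h (E.symm x) (E.symm y) (by simp [hxy])
        exact E.symm.injective this
    refine ⟨_, C, hC, ?_⟩
    simpa using four_mul_pow_lt hk
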